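/- Let $\mathbb T$ be the unit circle with normalized Lebesgue measure $m$, points written $e^{i\theta}$ with $-\pi<\theta\le\pi$. For a finite positive Borel measure $\rho$ on $\mathbb T$ and an integer $n\ge 1$ let $e_n(\rho)$ be the distance in $L^2(\rho)$ from the constant function $1$ to the set of algebraic polynomials (with complex coefficients) of degree at most $n$ that vanish at the origin. We say that $\rho$ satisfies condition $(\Theta)$ if $\sum_{n\ge1}e_n(\rho)^2<\infty$. At $\theta=0$ we read $\exp(\beta/|\theta|)=+\infty$ and $\exp(-\beta/|\theta|)=0$. (A) There is a numerical constant $K>0$ such that for every $\beta>0$ and every $I\ge 0$ there is a constant $C>0$ (depending only on $\beta$ and $I$) such that every finite positive measure $\rho$ on $\mathbb T$ with $$\int_{-\pi}^{\pi}\exp\Bigl(\frac{\beta}{|\theta|}\Bigr)\,d\rho(e^{i\theta})\le I$$ satisfies $e_n(\rho)\le C\,n^{-K\beta}$ for all $n\ge 1$. Consequently, if $\beta>1/(2K)$ and $\int_{-\pi}^{\pi}\exp(\beta/|\theta|)\,d\rho(e^{i\theta})<\infty$, then $\rho$ satisfies condition $(\Theta)$. (B) For every $\beta>0$ and $a>0$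 there is a constant $c>0$ (depending only on $\beta$ and $a$) such that every finite positive measure $\rho$ on $\mathbb T$ with $d\rho\ge a\exp(-\beta/|\theta|)\,dm$ satisfies $e_n(\rho)\ge c\,n^{-\beta/(2\pi)}$ for all $n\ge1$. Consequently, if moreover $\beta\le\pi$, then no such $\rho$ satisfies condition $(\Theta)$. -/

import Mathlib

open MeasureTheory Polynomial
open scoped ENNReal NNReal

/-- The unit circle `𝕋` carries its Borel sigma-algebra. -/
noncomputable instance ExpRoot.instMeasurableSpaceCircle : MeasurableSpace Circle := borel Circle

instance ExpRoot.instBorelSpaceCircle : BorelSpace Circle := ⟨rfl⟩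

noncomputable section

namespace ExpRoot

/-- The normalized Lebesgue measure `m` on the unit circle: the image of `dθ / (2π)` on `(-π, π]`
under `θ ↦ e^{iθ}`. -/
def m : Measure Circle :=
  (ENNReal.ofReal (2 * Real.pi))⁻¹ •
    Measure.map Circle.exp (volume.restrict (Set.Ioc (-Real.pi) Real.pi))

/-- `exp (β / |θ|)` at the point `t = e^{iθ}`, `-π < θ ≤ π`, with the value `∞` at `θ = 0`. -/
def expRootInv (β : ℝ) (t : Circle) : ℝ≥0∞ :=
  if Complex.arg t = 0 then ∞ else ENNReal.ofReal (Real.exp (β / |Complex.arg t|))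

/-- `exp (-β / |θ|)` at the point `t = e^{iθ}`, `-π < θ ≤ π`, with the value `0` at `θ = 0`. -/
def expRoot (β : ℝ) (t : Circle) : ℝ≥0∞ :=
  if Complex.arg t = 0 then 0 else ENNReal.ofReal (Real.exp (-β / |Complex.arg t|))

/-- A polynomial, viewed as a continuous function on the unit circle. -/
def polyOnCircle (P : ℂ[X]) : C(Circle, ℂ) where
  toFun t := P.eval (t : ℂ)
  continuous_toFun := P.continuous.comp continuous_subtype_val

/-- The class in `L²(ρ)` of a polynomial. -/
def polyLp (ρ : Measure Circle) [IsFiniteMeasure ρ] (P : ℂ[X]) : Lp ℂ 2 ρ :=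
  ContinuousMap.toLp 2 ρ ℂ (polyOnCircle P)

/-- The algebraic polynomials of degree at most `n` that vanish at the origin. -/
def polyZero (n : ℕ) : Set ℂ[X] :=
  {P | P.natDegree ≤ n ∧ P.eval 0 = 0}

/-- `e_n(ρ)`, the distance in `L²(ρ)` from the constant function `1` to the polynomials of degree
at most `n` that vanish at the origin. -/
def e (ρ : Measure Circle) [IsFiniteMeasure ρ] (n : ℕ) : ℝ :=
  Metric.infDist (polyLp ρ 1) (polyLp ρ '' polyZero n)

/-- Condition `(Θ)`: the series of `e_n(ρ)²` over `n ≥ 1` converges. -/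
def ConditionTheta (ρ : Measure Circle) [IsFiniteMeasure ρ] : Prop :=
  Summable fun n : ℕ => e ρ (n + 1) ^ 2

end ExpRoot

end

/-! Replacing `P` by `Q = 1 - P`, `e_n(ρ)²` is the infimum of `∫ |Q|² dρ` over polynomials `Q` of
degree at most `n` with `Q(0) = 1`.

(A) It suffices to find such a `Q` with `|Q(e^{iθ})| ≤ C n^{-Kβ} exp(β/(2|θ|))`. A sum of `J` dyadic
Fejér kernels, each minus its mean, is the real part of a polynomial `D` with `D(0) = 0` and degree
and modulus at most `2^J`; that real part is at most `4π/|θ| - J`. A Taylor polynomial of `exp(sD)`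
with about `2^J` terms has degree about `4^J` and still gains the factor `exp(-sJ)`, a power of `n`
when `4^J` is comparable to `n` (`exists_poly_small_off_one`).

(B) By Jensen, `log |Q|` has nonnegative mean on the circle. For `|θ| > d = 1/n`, the inequality
`log x ≤ x - 1` bounds that integral by the weighted `L²` norm plus `β ∫ dθ/|θ|`, which produces
`log n`. The arc `|θ| < d` is moved onto `(d, 3d)`; each zero of `Q` costs `O(d)`, hence `O(1)` in
all (`integral_logNorm_shift_le`, `exists_weightedSq_integral_ge`). -/

noncomputable section

namespace ExpRoot

/-! ### Fejér kernels and their dyadic sums -/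

/-- The polynomial `1 + X + ⋯ + X ^ (N - 1)`. -/
def geomPoly (N : ℕ) : ℂ[X] := ∑ k ∈ Finset.range N, X ^ k

/-- The polynomial vanishing at the origin whose real part on the unit circle is `N (F_N - 1)`, where
`F_N` is the Fejér kernel. -/
def fejerPoly (N : ℕ) : ℂ[X] := ∑ l ∈ Finset.range N, 2 * X * geomPoly l

/-- A dyadic average of Fejér kernels: its real part on the circle is about `1 / |θ| - J`. -/
def dyadicPoly (J : ℕ) : ℂ[X] :=
  ∑ j ∈ Finset.range J, C ((2 : ℂ) ^ j)⁻¹ * fejerPoly (2 ^ j)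

lemma geomPoly_succ (N : ℕ) : geomPoly (N + 1) = geomPoly N + X ^ N :=
  Finset.sum_range_succ _ _

lemma geomPoly_succ' (N : ℕ) : geomPoly (N + 1) = X * geomPoly N + 1 :=
  geom_sum_succ

lemma eval_geomPoly_mul (N : ℕ) (t : ℂ) : (geomPoly N).eval t * (t - 1) = t ^ N - 1 := by
  have := congrArg (eval t) (geom_sum_mul (X : ℂ[X]) N)
  simpa [geomPoly] using this

lemma natDegree_geomPoly_le (N : ℕ) : (geomPoly (N + 1)).natDegree ≤ N := by
  refine natDegree_sum_le_of_forall_le _ _ fun k hk => ?_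
  rw [natDegree_X_pow]
  exact Nat.lt_succ_iff.1 (Finset.mem_range.1 hk)

lemma norm_eval_geomPoly_le (N : ℕ) {t : ℂ} (ht : ‖t‖ = 1) : ‖(geomPoly N).eval t‖ ≤ N := by
  rw [geomPoly, eval_finsetSum]
  refine (norm_sum_le _ _).trans ?_
  simp [ht]

/-- Conjugation on the circle reverses the coefficients, because `conj t = t⁻¹`. This evaluates the
cross term in `norm_sq_eval_geomPoly`. -/
lemma mul_eval_geomPoly (N : ℕ) {t : ℂ} (ht : ‖t‖ = 1) :
    t * (geomPoly N).eval t = t ^ N * (starRingEnd ℂ) ((geomPoly N).eval t) := by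
  have h1 : t * (starRingEnd ℂ) t = 1 := by
    rw [Complex.mul_conj, Complex.normSq_eq_norm_sq, ht]; simp
  induction N with
  | zero => simp [geomPoly]
  | succ N ih =>
    have h2 : t ^ N * (starRingEnd ℂ) t ^ N = 1 := by rw [← mul_pow, h1, one_pow]
    conv_lhs => rw [geomPoly_succ']
    rw [geomPoly_succ]
    simp only [eval_add, eval_mul, eval_X, eval_one, eval_pow, map_add, map_pow]
    linear_combination t * ih - t * h2

/-- Passing from `N` to `N + 1` adds `1 + 2 Re (t * geomPoly N)` to the square, and the second term
is the real part of the new summand of `fejerPoly`. -/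
lemma norm_sq_eval_geomPoly (N : ℕ) {t : ℂ} (ht : ‖t‖ = 1) :
    ‖(geomPoly N).eval t‖ ^ 2 = N + ((fejerPoly N).eval t).re := by
  induction N with
  | zero => simp [geomPoly, fejerPoly]
  | succ N ih =>
    have h3 : ((geomPoly N).eval t * (starRingEnd ℂ) (t ^ N)).re
        = (t * (geomPoly N).eval t).re := by
      rw [mul_eval_geomPoly N ht, ← Complex.conj_re, map_mul, Complex.conj_conj, mul_comm]
    rw [fejerPoly, Finset.sum_range_succ, ← fejerPoly, geomPoly_succ, ← Complex.normSq_eq_norm_sq]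
    simp only [eval_add, eval_mul, eval_X, eval_pow, eval_ofNat]
    rw [Complex.normSq_add, h3, Complex.normSq_eq_norm_sq, Complex.normSq_eq_norm_sq, ih, norm_pow,
      ht, mul_assoc, Complex.add_re]
    simp only [Complex.mul_re, Complex.re_ofNat, Complex.im_ofNat]
    push_cast
    ring

lemma norm_eval_fejerPoly_le (N : ℕ) {t : ℂ} (ht : ‖t‖ = 1) :
    ‖(fejerPoly N).eval t‖ ≤ (N : ℝ) ^ 2 := by
  induction N with
  | zero => simp [fejerPoly]
  | succ N ih =>
    rw [fejerPoly, Finset.sum_range_succ, ← fejerPoly]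
    simp only [eval_add, eval_mul, eval_X, eval_ofNat]
    refine (norm_add_le _ _).trans ?_
    rw [norm_mul, norm_mul, ht]
    have := norm_eval_geomPoly_le N ht
    simp only [Complex.norm_ofNat]
    push_cast
    nlinarith

lemma natDegree_fejerPoly_le (N : ℕ) : (fejerPoly N).natDegree ≤ N := by
  refine natDegree_sum_le_of_forall_le _ _ fun l hl => ?_
  rcases l with _ | l
  · simp [geomPoly]
  · have h1 := natDegree_geomPoly_le l
    have h2 : (2 * X : ℂ[X]).natDegree ≤ 1 := by simp
    have := Finset.mem_range.1 hl
    exact natDegree_mul_le.trans (by omega)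

lemma natDegree_dyadicPoly_le (J : ℕ) : (dyadicPoly J).natDegree ≤ 2 ^ J := by
  refine natDegree_sum_le_of_forall_le _ _ fun j hj => ?_
  refine (natDegree_C_mul_le _ _).trans ((natDegree_fejerPoly_le _).trans ?_)
  exact Nat.pow_le_pow_right two_pos (Finset.mem_range.1 hj).le

lemma eval_zero_dyadicPoly (J : ℕ) : (dyadicPoly J).eval 0 = 0 := by
  simp [dyadicPoly, fejerPoly, eval_finsetSum]

lemma norm_eval_dyadicPoly_le (J : ℕ) {t : ℂ} (ht : ‖t‖ = 1) :
    ‖(dyadicPoly J).eval t‖ ≤ 2 ^ J := by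
  induction J with
  | zero => simp [dyadicPoly]
  | succ J ih =>
    rw [dyadicPoly, Finset.sum_range_succ, ← dyadicPoly, eval_add, eval_mul, eval_C]
    refine (norm_add_le _ _).trans ?_
    have h := norm_eval_fejerPoly_le (2 ^ J) ht
    have h2 : ‖((2 : ℂ) ^ J)⁻¹ * (fejerPoly (2 ^ J)).eval t‖ ≤ 2 ^ J := by
      rw [norm_mul, norm_inv, norm_pow, Complex.norm_ofNat, inv_mul_le_iff₀ (by positivity)]
      push_cast at h
      nlinarith
    rw [pow_succ]
    linarith

/-- A geometric sum cut off at the scale `a`. -/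
lemma sum_min_two_pow_le {a : ℝ} (ha : 0 < a) (J : ℕ) :
    ∑ j ∈ Finset.range J, min ((2 : ℝ) ^ j) (a ^ 2 / 2 ^ j) ≤ 4 * a := by
  -- Strengthened for induction: the subtracted `2 * (a ^ 2 / 2 ^ J)` is the tail `∑_{j ≥ J} a ^ 2 /
  -- 2 ^ j` not yet summed.
  suffices H : ∑ j ∈ Finset.range J, min ((2 : ℝ) ^ j) (a ^ 2 / 2 ^ j) ≤ 2 ^ J ∧
      (a ≤ 2 ^ J →
        ∑ j ∈ Finset.range J, min ((2 : ℝ) ^ j) (a ^ 2 / 2 ^ j) ≤ 4 * a - 2 * (a ^ 2 / 2 ^ J)) by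
    rcases le_total a (2 ^ J) with h | h
    · have : 0 ≤ a ^ 2 / 2 ^ J := by positivity
      linarith [H.2 h]
    · linarith [H.1]
  induction J with
  | zero =>
    simp only [Finset.range_zero, Finset.sum_empty, pow_zero, div_one]
    exact ⟨zero_le_one, fun h => by nlinarith⟩
  | succ J ih =>
    rw [Finset.sum_range_succ]
    have h1 : (2 : ℝ) ^ (J + 1) = 2 * 2 ^ J := by ring
    have h2 : a ^ 2 / 2 ^ (J + 1) = a ^ 2 / 2 ^ J / 2 := by rw [pow_succ 2 J, div_div]
    have h3 := min_le_left ((2 : ℝ) ^ J) (a ^ 2 / 2 ^ J)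
    have h4 := min_le_right ((2 : ℝ) ^ J) (a ^ 2 / 2 ^ J)
    refine ⟨by linarith [ih.1], fun h => ?_⟩
    rcases le_total a (2 ^ J) with h' | h'
    · rw [h2]; linarith [ih.2 h']
    · have h5 : a ^ 2 / 2 ^ (J + 1) ≤ a := by
        rw [div_le_iff₀ (by positivity)]; nlinarith
      linarith [ih.1]

lemma norm_exp_sub_exp (x y : ℝ) : ‖(Circle.exp x : ℂ) - Circle.exp y‖
    = ‖Complex.exp (Complex.I * ((x - y : ℝ) : ℂ)) - 1‖ := by
  have h1 : (Circle.exp x : ℂ) - Circle.exp y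
      = Circle.exp y * (Complex.exp (Complex.I * ((x - y : ℝ) : ℂ)) - 1) := by
    rw [mul_sub, mul_one, Circle.coe_exp, Circle.coe_exp, ← Complex.exp_add]
    push_cast
    ring_nf
  rw [h1, norm_mul, Circle.norm_coe, one_mul]

lemma norm_exp_sub_exp_ge {x y : ℝ} (h : |x - y| ≤ Real.pi) :
    2 / Real.pi * |x - y| ≤ ‖(Circle.exp x : ℂ) - Circle.exp y‖ := by
  rw [norm_exp_sub_exp, Complex.norm_exp_I_mul_ofReal_sub_one, norm_mul,
    Real.norm_ofNat, Real.norm_eq_abs]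
  have h2 : |(x - y) / 2| = |x - y| / 2 := by rw [abs_div, abs_two]
  have := Real.mul_abs_le_abs_sin (x := (x - y) / 2) (by rw [h2]; linarith)
  rw [h2] at this
  linarith

/-- The `j`-th summand has real part `F - 1`, where the Fejér kernel `F` of order `2^j` is at most
`2^j` and at most `(π/|θ|)² / 2^j`. The kernels sum geometrically; the `-1`s give `-J`. -/
lemma re_eval_dyadicPoly_le (J : ℕ) {θ : ℝ} (h0 : θ ≠ 0) (hθ : |θ| ≤ Real.pi) :
    ((dyadicPoly J).eval (Circle.exp θ : ℂ)).re ≤ 4 * (Real.pi / |θ|) - J := by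
  have ht : ‖(Circle.exp θ : ℂ)‖ = 1 := Circle.norm_coe _
  have hpos : 0 < |θ| := abs_pos.2 h0
  have ha : 0 < Real.pi / |θ| := div_pos Real.pi_pos hpos
  have hgeom (N : ℕ) : ‖(geomPoly N).eval (Circle.exp θ : ℂ)‖ ≤ Real.pi / |θ| := by
    have h1 := norm_exp_sub_exp_ge (x := θ) (y := 0) (by simpa using hθ)
    simp only [sub_zero, Circle.exp_zero, Circle.coe_one] at h1
    have h2 := congrArg norm (eval_geomPoly_mul N (Circle.exp θ : ℂ))
    have h3 : ‖(Circle.exp θ : ℂ) ^ N - 1‖ ≤ 2 := by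
      refine (norm_sub_le _ _).trans ?_
      rw [norm_pow, ht, one_pow, norm_one]; norm_num
    rw [norm_mul] at h2
    have h4 : ‖(geomPoly N).eval (Circle.exp θ : ℂ)‖ * (2 / Real.pi * |θ|) ≤ 2 :=
      (mul_le_mul_of_nonneg_left h1 (norm_nonneg _)).trans (h2.le.trans h3)
    rw [le_div_iff₀ hpos]
    have h5 : 2 / Real.pi * (‖(geomPoly N).eval (Circle.exp θ : ℂ)‖ * |θ|)
      ≤ 2 / Real.pi * Real.pi := by
      rw [div_mul_cancel₀ _ Real.pi_pos.ne']; linarith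
    exact le_of_mul_le_mul_left h5 (by positivity)
  have key (j : ℕ) : ((C ((2 : ℂ) ^ j)⁻¹ * fejerPoly (2 ^ j)).eval (Circle.exp θ : ℂ)).re
      ≤ min ((2 : ℝ) ^ j) ((Real.pi / |θ|) ^ 2 / 2 ^ j) - 1 := by
    have h1 := norm_sq_eval_geomPoly (2 ^ j) ht
    have h2 := norm_eval_geomPoly_le (2 ^ j) ht
    have h3 := hgeom (2 ^ j)
    simp only [Nat.cast_pow, Nat.cast_ofNat] at h1 h2
    have h4 : ((C ((2 : ℂ) ^ j)⁻¹ * fejerPoly (2 ^ j)).eval (Circle.exp θ : ℂ)).re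
        = ((fejerPoly (2 ^ j)).eval (Circle.exp θ : ℂ)).re / 2 ^ j := by
      rw [eval_mul, eval_C, div_eq_inv_mul, ← Complex.re_ofReal_mul]
      push_cast
      rfl
    have hp : (0 : ℝ) < 2 ^ j := by positivity
    rw [h4, le_sub_iff_add_le, le_min_iff]
    have h6 : ((fejerPoly (2 ^ j)).eval (Circle.exp θ : ℂ)).re / 2 ^ j + 1
        = ‖(geomPoly (2 ^ j)).eval (Circle.exp θ : ℂ)‖ ^ 2 / 2 ^ j := by
      rw [h1]; field_simp; ring
    rw [h6]
    refine ⟨?_, by gcongr⟩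
    rw [div_le_iff₀ hp, ← sq]
    gcongr
  rw [dyadicPoly, eval_finsetSum, Complex.re_sum]
  refine (Finset.sum_le_sum fun j _ => key j).trans ?_
  rw [Finset.sum_sub_distrib]
  simpa using sum_min_two_pow_le ha J

/-! ### Truncated exponentials: polynomials small off the point `1` -/

/-- The Taylor polynomial of order `M` of `exp (s * dyadicPoly J)`. -/
def expDyadicPoly (s : ℝ) (J M : ℕ) : ℂ[X] :=
  ∑ k ∈ Finset.range M, C ((s : ℂ) ^ k / k.factorial) * dyadicPoly J ^ k

lemma eval_expDyadicPoly (s : ℝ) (J M : ℕ) (t : ℂ) : (expDyadicPoly s J M).eval t =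
    ∑ k ∈ Finset.range M, (s * (dyadicPoly J).eval t) ^ k / k.factorial := by
  rw [expDyadicPoly, eval_finsetSum]
  refine Finset.sum_congr rfl fun k _ => ?_
  rw [eval_mul, eval_C, eval_pow, mul_pow, div_mul_eq_mul_div]

lemma natDegree_expDyadicPoly_le (s : ℝ) (J M : ℕ) :
    (expDyadicPoly s J M).natDegree ≤ M * 2 ^ J := by
  refine natDegree_sum_le_of_forall_le _ _ fun k hk => ?_
  refine (natDegree_C_mul_le _ _).trans (natDegree_pow_le.trans ?_)
  exact Nat.mul_le_mul (Finset.mem_range.1 hk).le (natDegree_dyadicPoly_le J)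

lemma eval_zero_expDyadicPoly (s : ℝ) (J : ℕ) {M : ℕ} (hM : 0 < M) :
    (expDyadicPoly s J M).eval 0 = 1 := by
  obtain ⟨M, rfl⟩ := Nat.exists_eq_succ_of_ne_zero hM.ne'
  rw [eval_expDyadicPoly, eval_zero_dyadicPoly, Finset.sum_range_succ']
  simp

/-- Truncation error for the exponential series, when far more terms are taken than the modulus of
the argument. -/
lemma norm_exp_sub_sum_le {z : ℂ} {M : ℕ} (h : 9 * ‖z‖ ≤ M) :
    ‖Complex.exp z - ∑ k ∈ Finset.range M, z ^ k / k.factorial‖ ≤ 2 * Real.exp (-M) := by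
  have hz := norm_nonneg z
  have h1 : ‖z‖ / M.succ ≤ 1 / 2 := by
    rw [div_le_iff₀ (by positivity)]; push_cast; linarith
  refine (Complex.exp_bound' h1).trans ?_
  rw [mul_comm]
  gcongr
  -- The factor `9` is an upper bound for `e²`: then `‖z‖ ≤ e⁻² M`, and `M ^ M / M! ≤ e ^ M` leaves
  -- `e ^ (-M)`.
  have he : Real.exp 2 ≤ 9 := by
    have := Real.exp_one_lt_three
    have h2 : Real.exp 2 = Real.exp 1 * Real.exp 1 := by rw [← Real.exp_add]; norm_num
    nlinarith [Real.exp_pos 1]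
  have h2 : (M : ℝ) ^ M / M.factorial ≤ Real.exp M :=
    Real.pow_div_factorial_le_exp _ (Nat.cast_nonneg _) _
  have h3 : ‖z‖ ≤ Real.exp (-2) * M := by
    rw [Real.exp_neg, ← div_eq_inv_mul, le_div_iff₀ (Real.exp_pos 2)]
    nlinarith
  calc ‖z‖ ^ M / M.factorial ≤ (Real.exp (-2) * M) ^ M / M.factorial := by gcongr
    _ = Real.exp (-2) ^ M * ((M : ℝ) ^ M / M.factorial) := by rw [mul_pow, mul_div_assoc]
    _ ≤ Real.exp (-2) ^ M * Real.exp M := by gcongr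
    _ = Real.exp (-M) := by
      rw [← Real.exp_nat_mul, ← Real.exp_add]; ring_nf

/-- The exponential itself contributes `1` to the constant `3`; the truncation error `2 e^{-M}`
contributes `2`, since `M ≥ s 2^J ≥ s J`. -/
lemma norm_eval_expDyadicPoly_le {s : ℝ} (hs : 0 < s) {J M : ℕ} (hM : 9 * s * 2 ^ J ≤ M) {θ : ℝ}
    (h0 : θ ≠ 0) (hθ : |θ| ≤ Real.pi) :
    ‖(expDyadicPoly s J M).eval (Circle.exp θ : ℂ)‖
      ≤ 3 * (Real.exp (-(s * J)) * Real.exp (4 * Real.pi * s / |θ|)) := by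
  set t : ℂ := (Circle.exp θ : ℂ) with ht
  have h1 : ‖(s : ℂ) * (dyadicPoly J).eval t‖ ≤ s * 2 ^ J := by
    rw [norm_mul, Complex.norm_real, Real.norm_eq_abs, abs_of_pos hs]
    gcongr
    exact norm_eval_dyadicPoly_le J (Circle.norm_coe _)
  have h2 := norm_exp_sub_sum_le (z := (s : ℂ) * (dyadicPoly J).eval t) (M := M) (by linarith)
  rw [← eval_expDyadicPoly] at h2
  have h3 : ‖Complex.exp (s * (dyadicPoly J).eval t)‖
      ≤ Real.exp (-(s * J)) * Real.exp (4 * Real.pi * s / |θ|) := by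
    rw [Complex.norm_exp, ← Real.exp_add, Complex.re_ofReal_mul]
    gcongr
    have := mul_le_mul_of_nonneg_left (re_eval_dyadicPoly_le J h0 hθ) hs.le
    refine this.trans (le_of_eq ?_)
    ring
  have h4 : Real.exp (-M) ≤ Real.exp (-(s * J)) * Real.exp (4 * Real.pi * s / |θ|) := by
    rw [← Real.exp_add]
    gcongr
    have h5 : (J : ℝ) ≤ 2 ^ J := by exact_mod_cast Nat.lt_two_pow_self.le
    have h6 : 0 ≤ 4 * Real.pi * s / |θ| := by have := Real.pi_pos; positivity
    nlinarith [mul_le_mul_of_nonneg_left h5 hs.le]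
  calc ‖(expDyadicPoly s J M).eval t‖
      = ‖Complex.exp (s * (dyadicPoly J).eval t)
        - (Complex.exp (s * (dyadicPoly J).eval t) - (expDyadicPoly s J M).eval t)‖ := by
        rw [sub_sub_cancel]
    _ ≤ _ := norm_sub_le _ _
    _ ≤ _ := by linarith

/-- Polynomials normalized at the origin that are small off the point `1`. -/
lemma exists_poly_small_off_one {β : ℝ} (hβ : 0 < β) :
    ∃ C : ℝ, 0 < C ∧ ∀ n : ℕ, 1 ≤ n → ∃ Q : ℂ[X], Q.natDegree ≤ n ∧ Q.eval 0 = 1 ∧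
      ∀ θ : ℝ, θ ≠ 0 → |θ| ≤ Real.pi → ‖Q.eval (Circle.exp θ : ℂ)‖ ≤
        C * (n : ℝ) ^ (-(1 / (16 * Real.pi) * β)) * Real.exp (β / (2 * |θ|)) := by
  have hpi := Real.pi_pos
  -- Chosen so that `4πs/|θ| = β/(2|θ|)`, whose exponential squares to `exp(β/|θ|)`.
  obtain ⟨s, hs⟩ : ∃ s : ℝ, s = β / (8 * Real.pi) := ⟨_, rfl⟩
  have hs0 : 0 < s := by rw [hs]; positivity
  have hK : 1 / (16 * Real.pi) * β = s / 2 := by rw [hs]; field_simp; norm_num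
  -- `B * 2 ^ J` Taylor terms suffice for the truncation bound, at total degree at most `B * 4 ^ J`.
  obtain ⟨B, hB⟩ : ∃ B : ℕ, 9 * s + 1 ≤ B := exists_nat_ge _
  have hB1 : (1 : ℝ) ≤ B := by linarith
  have hB0 : 0 < B := by exact_mod_cast (zero_lt_one.trans_le hB1)
  refine ⟨3 * (B : ℝ) ^ (s / 2) * Real.exp s, by positivity, fun n hn => ?_⟩
  have hn0 : (0 : ℝ) < n := by exact_mod_cast hn
  have hexp (θ : ℝ) : 4 * Real.pi * s / |θ| = β / (2 * |θ|) := by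
    rw [hs]; field_simp; norm_num
  rw [hK]
  -- The exponent `s / 2` comes from rounding `4` up to `e²`; `s / log 4` would be exact here.
  have small (J : ℕ) (hJ : (n : ℝ) ≤ B * 4 ^ (J + 1)) :
      Real.exp (-(s * J)) ≤ (B : ℝ) ^ (s / 2) * Real.exp s * (n : ℝ) ^ (-(s / 2)) := by
    have h1 : (n : ℝ) ≤ B * Real.exp (2 * (J + 1)) := by
      refine hJ.trans ?_
      gcongr
      have h4 : (4 : ℝ) ≤ Real.exp 2 := by
        have := Real.exp_one_gt_two
        have h2 : Real.exp 2 = Real.exp 1 * Real.exp 1 := by rw [← Real.exp_add]; norm_num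
        nlinarith
      calc (4 : ℝ) ^ (J + 1) ≤ Real.exp 2 ^ (J + 1) := by gcongr
        _ = _ := by rw [← Real.exp_nat_mul]; push_cast; ring_nf
    have h2 : (n : ℝ) ^ (s / 2) ≤ (B : ℝ) ^ (s / 2) * Real.exp (s * (J + 1)) := by
      calc (n : ℝ) ^ (s / 2) ≤ (B * Real.exp (2 * (J + 1))) ^ (s / 2) := by gcongr
        _ = _ := by
          rw [Real.mul_rpow (by positivity) (by positivity), ← Real.exp_mul]; ring_nf
    rw [Real.rpow_neg hn0.le, ← div_eq_mul_inv, le_div_iff₀ (by positivity)]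
    calc Real.exp (-(s * J)) * (n : ℝ) ^ (s / 2)
        ≤ Real.exp (-(s * J)) * ((B : ℝ) ^ (s / 2) * Real.exp (s * (J + 1))) := by gcongr
      _ = (B : ℝ) ^ (s / 2) * (Real.exp (-(s * J)) * Real.exp (s * (J + 1))) := by ring
      _ = _ := by rw [← Real.exp_add]; ring_nf
  rcases lt_or_ge n B with hlt | hge
  · refine ⟨1, by simp, by simp, fun θ _ _ => ?_⟩
    have h1 := small 0 (by
      have : (n : ℝ) ≤ B := by exact_mod_cast hlt.le
      norm_num; linarith)
    have h2 : 1 ≤ Real.exp (β / (2 * |θ|)) := Real.one_le_exp (by positivity)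
    simp only [Nat.cast_zero, mul_zero, neg_zero, Real.exp_zero] at h1
    rw [eval_one, norm_one]
    nlinarith
  -- The largest `J` with `B * 4 ^ J ≤ n`.
  · set J := Nat.log 4 (n / B) with hJ
    have h1 : 4 ^ J ≤ n / B := Nat.pow_log_le_self 4 (Nat.div_pos hge hB0).ne'
    have h2 : n / B < 4 ^ (J + 1) := Nat.lt_pow_succ_log_self (by norm_num) _
    have h3 : B * 4 ^ J ≤ n := by
      rw [mul_comm]; exact (Nat.le_div_iff_mul_le hB0).1 h1
    have h4 : n < 4 ^ (J + 1) * B := (Nat.div_lt_iff_lt_mul hB0).1 h2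
    refine ⟨expDyadicPoly s J (B * 2 ^ J), ?_, eval_zero_expDyadicPoly s J (by positivity), ?_⟩
    · refine (natDegree_expDyadicPoly_le _ _ _).trans (le_trans (le_of_eq ?_) h3)
      rw [mul_assoc, ← mul_pow]; norm_num
    · intro θ h0 hθ
      refine (norm_eval_expDyadicPoly_le hs0 ?_ h0 hθ).trans ?_
      · push_cast; gcongr; linarith
      · have h5 := small J (by rw [mul_comm]; exact_mod_cast h4.le)
        rw [hexp]
        have h6 := mul_le_mul_of_nonneg_right h5 (Real.exp_pos (β / (2 * |θ|))).le
        linarith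


/-! ### Translating a short arc -/

lemma coe_circleExp_eq_circleMap (θ : ℝ) : (Circle.exp θ : ℂ) = circleMap 0 1 θ := by
  simp [circleMap]

lemma norm_exp_sub_exp_le (x y : ℝ) : ‖(Circle.exp x : ℂ) - Circle.exp y‖ ≤ |x - y| := by
  rw [norm_exp_sub_exp]
  exact Real.norm_exp_I_mul_ofReal_sub_one_le

/-- With `φ₀` the nearest parameter to `z`, the chord from `φ` to `φ₀` is at most twice the distance
from `φ` to `z`, and it is at least `2/π` times the arc. An arbitrary zero `z` is thus traded for a
point of the arc. -/
lemma exists_nearest_on_arc {a b : ℝ} (hab : a ≤ b) (hπ : b - a ≤ Real.pi) (z : ℂ) :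
    ∃ φ₀ ∈ Set.Icc a b, ∀ φ ∈ Set.Icc a b, |φ - φ₀| / Real.pi ≤ ‖(Circle.exp φ : ℂ) - z‖ := by
  have hc : Continuous fun φ : ℝ => ‖(Circle.exp φ : ℂ) - z‖ := by fun_prop
  obtain ⟨φ₀, h0, hmin⟩ := isCompact_Icc.exists_isMinOn (Set.nonempty_Icc.2 hab) hc.continuousOn
  refine ⟨φ₀, h0, fun φ hφ => ?_⟩
  have h1 : ‖(Circle.exp φ₀ : ℂ) - z‖ ≤ ‖(Circle.exp φ : ℂ) - z‖ := hmin hφ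
  have h2 : |φ - φ₀| ≤ Real.pi :=
    (abs_sub_le_of_le_of_le hφ.1 hφ.2 h0.1 h0.2).trans hπ
  have h3 := norm_exp_sub_exp_ge h2
  have h4 := norm_sub_le_norm_sub_add_norm_sub (Circle.exp φ : ℂ) z (Circle.exp φ₀)
  rw [norm_sub_rev z] at h4
  have h5 : 2 / Real.pi * |φ - φ₀| = 2 * (|φ - φ₀| / Real.pi) := by ring
  linarith

lemma mul_log_sub_log_le {c x : ℝ} (hc : 0 < c) (hx : 0 ≤ x) :
    x * (Real.log c - Real.log x) ≤ c := by
  rcases hx.eq_or_lt with rfl | hx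
  · simpa using hc.le
  · rw [← Real.log_div hc.ne' hx.ne']
    calc x * Real.log (c / x) ≤ x * (c / x) :=
          mul_le_mul_of_nonneg_left (Real.log_le_self (by positivity)) hx.le
      _ = c := by field_simp

/-- Translating a short arc changes the modulus of `X - C z` by a factor of bounded logarithmic
mean. -/
lemma exists_shift_bound_X_sub_C {d : ℝ} (hd : 0 < d) (hdπ : 2 * d ≤ Real.pi) (z : ℂ) :
    ∃ g : ℝ → ℝ, IntervalIntegrable g volume d (3 * d) ∧ ∫ φ in d..(3 * d), g φ ≤ 22 * d ∧
      ∀ᵐ φ : ℝ, φ ∈ Set.Icc d (3 * d) →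
        ‖(Circle.exp (φ - 2 * d) : ℂ) - z‖ ≤ ‖(Circle.exp φ : ℂ) - z‖ * Real.exp (g φ) := by
  obtain ⟨φ₀, h0, hφ₀⟩ := exists_nearest_on_arc (a := d) (b := 3 * d) (by linarith) (by linarith) z
  have hint : IntervalIntegrable (fun φ => Real.log (φ - φ₀)) volume d (3 * d) := by
    have := (intervalIntegral.intervalIntegrable_log' (a := d - φ₀) (b := 3 * d - φ₀)).comp_sub_right
      φ₀
    simpa using this
  -- `Real.log` ignores sign, so `exp g = 10d/|φ - φ₀|`. Here `10 = 8 + 2`: `8` pays for the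
  -- displacement `2d` (using `π ≤ 4`), `2` for the original distance. The two endpoint terms of the
  -- integral cost `10d` each, and the `-x` in the primitive of `log x` costs `2d`, giving `22d`.
  refine ⟨fun φ => Real.log (10 * d) - Real.log (φ - φ₀), intervalIntegrable_const.sub hint, ?_, ?_⟩
  · rw [intervalIntegral.integral_sub intervalIntegrable_const hint,
      intervalIntegral.integral_comp_sub_right, integral_log, intervalIntegral.integral_const,
      smul_eq_mul, ← Real.log_neg_eq_log (d - φ₀)]
    have h1 := mul_log_sub_log_le (c := 10 * d) (x := 3 * d - φ₀) (by linarith) (by linarith [h0.2])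
    have h2 := mul_log_sub_log_le (c := 10 * d) (x := -(d - φ₀)) (by linarith) (by linarith [h0.1])
    linarith
  · have hne : ∀ᵐ φ : ℝ, φ ≠ φ₀ := by simp [ae_iff]
    filter_upwards [hne] with φ hφ hφI
    have hs : 0 < |φ - φ₀| := abs_pos.2 (sub_ne_zero.2 hφ)
    have hs2 : |φ - φ₀| ≤ 2 * d :=
      (abs_sub_le_of_le_of_le hφI.1 hφI.2 h0.1 h0.2).trans (by linarith)
    have h1 := hφ₀ φ hφI
    have hexp : Real.exp (Real.log (10 * d) - Real.log (φ - φ₀)) = 10 * d / |φ - φ₀| := by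
      rw [← Real.log_abs (φ - φ₀), Real.exp_sub, Real.exp_log (by positivity), Real.exp_log hs]
    have h2 := norm_exp_sub_exp_le (φ - 2 * d) φ
    have h3 : |φ - 2 * d - φ| = 2 * d := by
      rw [show φ - 2 * d - φ = -(2 * d) by ring, abs_neg, abs_of_pos (by linarith)]
    have h4 := norm_sub_le_norm_sub_add_norm_sub (Circle.exp (φ - 2 * d) : ℂ) (Circle.exp φ) z
    have h5 : 2 * d ≤ ‖(Circle.exp φ : ℂ) - z‖ * (8 * d / |φ - φ₀|) := by
      have h6 : 2 * d ≤ |φ - φ₀| / Real.pi * (8 * d / |φ - φ₀|) := by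
        rw [div_mul_div_comm, le_div_iff₀ (by have := Real.pi_pos; positivity)]
        have := Real.pi_le_four
        have h8 : 0 < d * |φ - φ₀| := by positivity
        nlinarith
      exact h6.trans (by gcongr)
    have h7 : ‖(Circle.exp φ : ℂ) - z‖ ≤ ‖(Circle.exp φ : ℂ) - z‖ * (2 * d / |φ - φ₀|) := by
      refine le_mul_of_one_le_right (norm_nonneg _) ?_
      rwa [one_le_div hs]
    rw [hexp]
    have h9 : ‖(Circle.exp φ : ℂ) - z‖ * (10 * d / |φ - φ₀|)
        = ‖(Circle.exp φ : ℂ) - z‖ * (8 * d / |φ - φ₀|)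
          + ‖(Circle.exp φ : ℂ) - z‖ * (2 * d / |φ - φ₀|) := by ring
    linarith

/-- Factor `Q` over its roots and add the functions `g` of the linear factors; the leading
coefficient appears on both sides. -/
lemma exists_shift_bound {d : ℝ} (hd : 0 < d) (hdπ : 2 * d ≤ Real.pi) (Q : ℂ[X]) :
    ∃ g : ℝ → ℝ, IntervalIntegrable g volume d (3 * d) ∧
      ∫ φ in d..(3 * d), g φ ≤ Q.natDegree * (22 * d) ∧
      ∀ᵐ φ : ℝ, φ ∈ Set.Icc d (3 * d) →
        ‖Q.eval (Circle.exp (φ - 2 * d) : ℂ)‖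
          ≤ ‖Q.eval (Circle.exp φ : ℂ)‖ * Real.exp (g φ) := by
  have key (s : Multiset ℂ) : ∃ g : ℝ → ℝ, IntervalIntegrable g volume d (3 * d) ∧
      ∫ φ in d..(3 * d), g φ ≤ s.card * (22 * d) ∧
      ∀ᵐ φ : ℝ, φ ∈ Set.Icc d (3 * d) →
        ‖(s.map fun a => X - C a).prod.eval (Circle.exp (φ - 2 * d) : ℂ)‖
          ≤ ‖(s.map fun a => X - C a).prod.eval (Circle.exp φ : ℂ)‖ * Real.exp (g φ) := by
    induction s using Multiset.induction_on with
    | empty => exact ⟨0, intervalIntegrable_const, by simp, by simp⟩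
    | cons z s ih =>
      obtain ⟨g, hg, hgi, hgb⟩ := ih
      obtain ⟨k, hk, hki, hkb⟩ := exists_shift_bound_X_sub_C hd hdπ z
      refine ⟨fun φ => k φ + g φ, hk.add hg, ?_, ?_⟩
      · rw [intervalIntegral.integral_add hk hg, Multiset.card_cons]
        push_cast
        linarith
      · filter_upwards [hgb, hkb] with φ h1 h2 hφ
        simp only [Multiset.map_cons, Multiset.prod_cons, eval_mul, eval_sub, eval_X, eval_C,
          norm_mul, Real.exp_add]
        calc _ ≤ _ := mul_le_mul (h2 hφ) (h1 hφ) (norm_nonneg _) (by positivity)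
          _ = _ := by ring
  have hs := IsAlgClosed.splits Q
  obtain ⟨g, hg, hgi, hgb⟩ := key Q.roots
  refine ⟨g, hg, ?_, ?_⟩
  · rwa [hs.natDegree_eq_card_roots]
  · filter_upwards [hgb] with φ h hφ
    rw [hs.eq_prod_roots, eval_mul, eval_mul, norm_mul, norm_mul, eval_C, eval_C, mul_assoc]
    exact mul_le_mul_of_nonneg_left (h hφ) (norm_nonneg _)

lemma ae_eval_circleExp_ne_zero {Q : ℂ[X]} (hQ : Q ≠ 0) :
    ∀ᵐ φ : ℝ, Q.eval (Circle.exp φ : ℂ) ≠ 0 := by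
  have h1 : {z : ℂ | Q.eval z = 0}.Countable := (Q.rootSet_finite ℂ).countable.mono (by
    intro z hz
    rw [mem_rootSet]
    exact ⟨hQ, by simpa using hz⟩)
  have h2 := (h1.preimage_circleMap 0 one_ne_zero).measure_zero volume
  rw [ae_iff]
  convert h2 using 2
  ext φ
  simp [circleMap]

/-! ### Logarithmic integrals and the weighted lower bound -/

/-- `log |Q|` along the unit circle. -/
def logNorm (Q : ℂ[X]) (θ : ℝ) : ℝ := Real.log ‖Q.eval (Circle.exp θ : ℂ)‖

lemma logNorm_periodic (Q : ℂ[X]) : Function.Periodic (logNorm Q) (2 * Real.pi) := by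
  intro θ
  rw [logNorm, logNorm, Circle.periodic_exp θ]

lemma intervalIntegrable_logNorm (Q : ℂ[X]) (a b : ℝ) :
    IntervalIntegrable (logNorm Q) volume a b := by
  refine (logNorm_periodic Q).intervalIntegrable₀ Real.two_pi_pos.ne' ?_ a b
  refine (intervalIntegrable_mahlerMeasure Q).congr fun θ _ => ?_
  simp only [logNorm, coe_circleExp_eq_circleMap]

/-- Jensen's inequality for polynomials. -/
lemma integral_logNorm_nonneg {Q : ℂ[X]} (hQ : Q.eval 0 = 1) :
    0 ≤ ∫ θ in (-Real.pi)..Real.pi, logNorm Q θ := by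
  have hQ0 : Q ≠ 0 := by rintro rfl; simp at hQ
  -- At index `0` this reads `|Q(0)| ≤` Mahler measure, whose logarithm is the circle mean of `log
  -- |Q|`.
  have h1 := norm_coeff_le_choose_mul_mahlerMeasure 0 Q
  rw [coeff_zero_eq_eval_zero, hQ, norm_one, Nat.choose_zero_right, Nat.cast_one, one_mul,
    mahlerMeasure_def_of_ne_zero hQ0, Real.one_le_exp_iff] at h1
  have h2 := (logNorm_periodic Q).intervalIntegral_add_eq (-Real.pi) 0
  rw [show -Real.pi + 2 * Real.pi = Real.pi by ring, zero_add] at h2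
  rw [h2]
  simp only [logNorm, coe_circleExp_eq_circleMap]
  exact nonneg_of_mul_nonneg_right h1 (by have := Real.pi_pos; positivity)

/-- Near `θ = 0` the weight is too small to control `log |Q|`, as `1/|θ|` is not integrable there;
this moves the problem to an adjacent arc of the same length. -/
lemma integral_logNorm_shift_le {d : ℝ} (hd : 0 < d) (hdπ : 2 * d ≤ Real.pi) {Q : ℂ[X]}
    (hQ : Q ≠ 0) : ∫ θ in (-d)..d, logNorm Q θ
      ≤ (∫ θ in d..(3 * d), logNorm Q θ) + Q.natDegree * (22 * d) := by
  obtain ⟨g, hg, hgi, hgb⟩ := exists_shift_bound hd hdπ Q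
  have h1 : ∫ θ in (-d)..d, logNorm Q θ = ∫ φ in d..(3 * d), logNorm Q (φ - 2 * d) := by
    rw [intervalIntegral.integral_comp_sub_right]
    congr 1 <;> ring
  have h2 : IntervalIntegrable (fun φ => logNorm Q (φ - 2 * d)) volume d (3 * d) := by
    have := (intervalIntegrable_logNorm Q (d - 2 * d) (3 * d - 2 * d)).comp_sub_right (2 * d)
    simpa using this
  have h3 : ∀ᵐ φ : ℝ, Q.eval (Circle.exp (φ - 2 * d) : ℂ) ≠ 0 :=
    (measurePreserving_sub_right volume (2 * d)).quasiMeasurePreserving.ae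
      (ae_eval_circleExp_ne_zero hQ)
  have h4 : ∫ φ in d..(3 * d), logNorm Q (φ - 2 * d)
      ≤ ∫ φ in d..(3 * d), (logNorm Q φ + g φ) := by
    refine intervalIntegral.integral_mono_ae_restrict (by linarith) h2
      ((intervalIntegrable_logNorm Q _ _).add hg) ?_
    rw [Filter.EventuallyLE, ae_restrict_iff' measurableSet_Icc]
    filter_upwards [h3, ae_eval_circleExp_ne_zero hQ, hgb] with φ ha hb hc hφ
    have := Real.log_le_log (norm_pos_iff.2 ha) (hc hφ)
    rwa [Real.log_mul (norm_ne_zero_iff.2 hb) (Real.exp_ne_zero _), Real.log_exp] at this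
  rw [intervalIntegral.integral_add (intervalIntegrable_logNorm Q _ _) hg] at h4
  linarith

/-- `|Q|² exp (-β / |θ|)` along the unit circle. -/
def weightedSq (β : ℝ) (Q : ℂ[X]) (θ : ℝ) : ℝ :=
  ‖Q.eval (Circle.exp θ : ℂ)‖ ^ 2 * Real.exp (-β / |θ|)

lemma weightedSq_nonneg (β : ℝ) (Q : ℂ[X]) (θ : ℝ) : 0 ≤ weightedSq β Q θ := by
  unfold weightedSq; positivity

lemma intervalIntegrable_abs_inv {p q : ℝ} (h0 : (0 : ℝ) ∉ Set.uIcc p q) :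
    IntervalIntegrable (fun θ : ℝ => |θ|⁻¹) volume p q :=
  ContinuousOn.intervalIntegrable (continuous_abs.continuousOn.inv₀ fun _ hθ =>
    abs_ne_zero.2 (ne_of_mem_of_not_mem hθ h0))

lemma intervalIntegrable_weightedSq (β : ℝ) (Q : ℂ[X]) {p q : ℝ} (h0 : (0 : ℝ) ∉ Set.uIcc p q) :
    IntervalIntegrable (weightedSq β Q) volume p q := by
  refine ContinuousOn.intervalIntegrable (ContinuousOn.mul ?_ ?_)
  · have : Continuous fun θ : ℝ => (Circle.exp θ : ℂ) := by fun_prop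
    exact ((Q.continuous.comp this).norm.pow 2).continuousOn
  · refine Real.continuous_exp.comp_continuousOn (continuousOn_const.div
      continuous_abs.continuousOn fun θ hθ => abs_ne_zero.2 (ne_of_mem_of_not_mem hθ h0))

/-- Integrate `log x ≤ x - 1` at `x = weightedSq β Q θ / A`. The free level `A` later becomes the
claimed lower bound. -/
lemma integral_logNorm_le (β : ℝ) {Q : ℂ[X]} (hQ : Q ≠ 0) {A : ℝ} (hA : 0 < A) {p q : ℝ}
    (hpq : p ≤ q) (h0 : (0 : ℝ) ∉ Set.uIcc p q) :
    2 * ∫ θ in p..q, logNorm Q θ ≤ (∫ θ in p..q, weightedSq β Q θ) / A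
      + (Real.log A - 1) * (q - p) + β * ∫ θ in p..q, |θ|⁻¹ := by
  have i1 := (intervalIntegrable_weightedSq β Q h0).div_const A
  have i2 : IntervalIntegrable (fun _ : ℝ => Real.log A - 1) volume p q := intervalIntegrable_const
  have i3 := (intervalIntegrable_abs_inv h0).const_mul β
  have h1 : ∫ θ in p..q, 2 * logNorm Q θ
      ≤ ∫ θ in p..q, (weightedSq β Q θ / A + (Real.log A - 1) + β * |θ|⁻¹) := by
    refine intervalIntegral.integral_mono_ae hpq ((intervalIntegrable_logNorm Q p q).const_mul 2)
      ((i1.add i2).add i3) ?_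
    filter_upwards [ae_eval_circleExp_ne_zero hQ] with θ hθ
    have hn : 0 < ‖Q.eval (Circle.exp θ : ℂ)‖ := norm_pos_iff.2 hθ
    have h2 : Real.log (weightedSq β Q θ / A) = 2 * logNorm Q θ - β * |θ|⁻¹ - Real.log A := by
      rw [weightedSq, Real.log_div (by positivity) hA.ne', Real.log_mul (by positivity)
        (Real.exp_ne_zero _), Real.log_exp, Real.log_pow, logNorm]
      push_cast
      ring
    have h3 := Real.log_le_sub_one_of_pos (x := weightedSq β Q θ / A) (by
      unfold weightedSq; positivity)
    rw [h2] at h3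
    linarith
  rw [intervalIntegral.integral_const_mul, intervalIntegral.integral_add (i1.add i2) i3,
    intervalIntegral.integral_add i1 i2, intervalIntegral.integral_div,
    intervalIntegral.integral_const_mul, intervalIntegral.integral_const, smul_eq_mul] at h1
  linarith

lemma integral_abs_inv {p q : ℝ} (hp : 0 < p) (hq : 0 < q) :
    ∫ θ in p..q, |θ|⁻¹ = Real.log (q / p) := by
  rw [← integral_inv_of_pos hp hq]
  refine intervalIntegral.integral_congr fun θ hθ => ?_
  have : 0 < θ := (lt_min hp hq).trans_le hθ.1
  simp only [abs_of_pos this]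

lemma integral_abs_inv_neg {p q : ℝ} (hp : 0 < p) (hq : 0 < q) :
    ∫ θ in (-q)..(-p), |θ|⁻¹ = Real.log (q / p) := by
  rw [← integral_abs_inv hp hq, ← intervalIntegral.integral_comp_neg]
  simp only [abs_neg]

/-- The weighted `L²` norm, off a neighbourhood of `1`, of a polynomial normalized at the origin is
bounded below. -/
lemma exists_weightedSq_integral_ge (β : ℝ) : ∃ c : ℝ, 0 < c ∧
    ∀ n : ℕ, 1 ≤ n → ∀ Q : ℂ[X], Q.natDegree ≤ n → Q.eval 0 = 1 →
      c * (n : ℝ) ^ (-(β / Real.pi)) ≤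
        (∫ θ in (-Real.pi)..(-(1 / (n : ℝ))), weightedSq β Q θ)
          + ∫ θ in (1 / (n : ℝ))..Real.pi, weightedSq β Q θ := by
  have hpi := Real.pi_pos
  have hpi3 := Real.pi_gt_three
  -- `46 = 2 * 22 + 2`: twice the translation cost, plus the bound `2` on the weighted integrals
  -- divided by `A`. The `log 3` comes from the arc `(d, 3d)`.
  refine ⟨Real.exp (-((46 + 2 * β * Real.log Real.pi + β * Real.log 3) / (2 * Real.pi))),
    Real.exp_pos _, fun n hn Q hdeg hQ => ?_⟩
  have hQ0 : Q ≠ 0 := by rintro rfl; simp at hQ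
  have hn0 : (0 : ℝ) < n := by exact_mod_cast hn
  have hn1 : (1 : ℝ) ≤ n := by exact_mod_cast hn
  obtain ⟨d, hd⟩ : ∃ d : ℝ, d = 1 / (n : ℝ) := ⟨_, rfl⟩
  have hd0 : 0 < d := by rw [hd]; positivity
  have hd1 : d ≤ 1 := by rw [hd]; exact (div_le_one hn0).2 hn1
  have hnd : (n : ℝ) * d = 1 := by rw [hd]; field_simp
  rw [← hd]
  by_contra! hlt
  set A := Real.exp (-((46 + 2 * β * Real.log Real.pi + β * Real.log 3) / (2 * Real.pi)))
    * (n : ℝ) ^ (-(β / Real.pi)) with hA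
  have hA0 : 0 < A := by positivity
  have hlogA : 2 * Real.pi * Real.log A = -(46 + 2 * β * Real.log Real.pi + β * Real.log 3)
      - 2 * β * Real.log n := by
    rw [hA, Real.log_mul (by positivity) (by positivity), Real.log_exp, Real.log_rpow hn0]
    field_simp
    ring
  have z1 : (0 : ℝ) ∉ Set.uIcc (-Real.pi) (-d) := by
    rw [Set.uIcc_of_le (by linarith), Set.mem_Icc]; rintro ⟨_, h⟩; linarith
  have z2 : (0 : ℝ) ∉ Set.uIcc d Real.pi := by
    rw [Set.uIcc_of_le (by linarith), Set.mem_Icc]; rintro ⟨h, _⟩; linarith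
  have z3 : (0 : ℝ) ∉ Set.uIcc d (3 * d) := by
    rw [Set.uIcc_of_le (by linarith), Set.mem_Icc]; rintro ⟨h, _⟩; linarith
  have b1 := integral_logNorm_le β hQ0 hA0 (p := -Real.pi) (q := -d) (by linarith) z1
  have b2 := integral_logNorm_le β hQ0 hA0 (p := d) (q := Real.pi) (by linarith) z2
  have b3 := integral_logNorm_le β hQ0 hA0 (p := d) (q := 3 * d) (by linarith) z3
  rw [integral_abs_inv_neg hd0 hpi] at b1
  rw [integral_abs_inv hd0 hpi] at b2
  rw [integral_abs_inv hd0 (by linarith), mul_div_assoc, div_self hd0.ne', mul_one] at b3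
  have hlogd : Real.log (Real.pi / d) = Real.log Real.pi + Real.log n := by
    rw [hd, div_div_eq_mul_div, div_one, Real.log_mul hpi.ne' hn0.ne']
  rw [hlogd] at b1 b2
  have c1 := integral_logNorm_nonneg hQ
  have c2 := integral_logNorm_shift_le hd0 (by linarith) hQ0
  have c3 : (Q.natDegree : ℝ) * (22 * d) ≤ 22 := by
    have : (Q.natDegree : ℝ) ≤ n := by exact_mod_cast hdeg
    nlinarith
  have I := intervalIntegrable_logNorm Q
  rw [← intervalIntegral.integral_add_adjacent_intervals (I (-Real.pi) d) (I d Real.pi),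
    ← intervalIntegral.integral_add_adjacent_intervals (I (-Real.pi) (-d)) (I (-d) d)] at c1
  have c4 : ∫ θ in d..(3 * d), weightedSq β Q θ ≤ ∫ θ in d..Real.pi, weightedSq β Q θ := by
    refine intervalIntegral.integral_mono_interval le_rfl (by linarith) (by linarith)
      (ae_of_all _ (weightedSq_nonneg β Q)) (intervalIntegrable_weightedSq β Q z2)
  have c5 : 0 ≤ ∫ θ in (-Real.pi)..(-d), weightedSq β Q θ :=
    intervalIntegral.integral_nonneg (by linarith) fun θ _ => weightedSq_nonneg β Q θ
  have c6 : (∫ θ in (-Real.pi)..(-d), weightedSq β Q θ) / A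
      + (∫ θ in d..Real.pi, weightedSq β Q θ) / A
      + (∫ θ in d..(3 * d), weightedSq β Q θ) / A ≤ 2 := by
    rw [← add_div, ← add_div, div_le_iff₀ hA0]
    linarith
  -- In the doubled inequality `0 ≤ 2 ∫ log |Q|`, the factor `log A - 1` carries total length `2(π -
  -- d) + 2d = 2π`. By the choice of `A` all other terms cancel, leaving `0 ≤ -2π`.
  nlinarith


/-! ### Passage to distances in `L²(ρ)` -/

lemma ofReal_dist_sq (ρ : Measure Circle) [IsFiniteMeasure ρ] (P : ℂ[X]) :
    ENNReal.ofReal (dist (polyLp ρ 1) (polyLp ρ P) ^ 2)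
      = ∫⁻ t : Circle, ENNReal.ofReal (‖(1 - P).eval (t : ℂ)‖ ^ 2) ∂ρ := by
  have h1 : polyLp ρ 1 - polyLp ρ P = polyLp ρ (1 - P) := by
    rw [polyLp, polyLp, polyLp, ← map_sub]
    congr 1
    ext t
    simp [polyOnCircle]
  have h2 : polyLp ρ (1 - P) =ᵐ[ρ] polyOnCircle (1 - P) := ContinuousMap.coeFn_toLp ρ _
  rw [dist_eq_norm, h1, ENNReal.ofReal_pow (norm_nonneg _), ofReal_norm, Lp.enorm_def,
    eLpNorm_congr_ae h2,
    eLpNorm_eq_lintegral_rpow_enorm_toReal two_ne_zero ENNReal.ofNat_ne_top, ← ENNReal.rpow_natCast,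
    ← ENNReal.rpow_mul]
  norm_num
  refine lintegral_congr fun t => ?_
  rw [← ofReal_norm, ← ENNReal.ofReal_pow (norm_nonneg _)]
  simp [polyOnCircle]

lemma measurable_expRoot (β : ℝ) : Measurable (expRoot β) := by
  have hc : Continuous fun t : Circle => (t : ℂ) := continuous_subtype_val
  have h : Measurable fun t : Circle => Complex.arg t := Complex.measurable_arg.comp hc.measurable
  exact Measurable.ite (h (measurableSet_singleton 0)) measurable_const
    (Real.measurable_exp.comp (measurable_const.div (measurable_norm.comp h))).ennreal_ofReal

/-! ### Upper bound -/

lemma lintegral_norm_sq_le {β : ℝ} {M : ℝ} (hM : 0 < M) {Q : ℂ[X]}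
    (hQ : ∀ θ : ℝ, θ ≠ 0 → |θ| ≤ Real.pi →
      ‖Q.eval (Circle.exp θ : ℂ)‖ ≤ M * Real.exp (β / (2 * |θ|))) (ρ : Measure Circle) :
    ∫⁻ t : Circle, ENNReal.ofReal (‖Q.eval (t : ℂ)‖ ^ 2) ∂ρ
      ≤ ENNReal.ofReal (M ^ 2) * ∫⁻ t, expRootInv β t ∂ρ := by
  rw [← lintegral_const_mul' _ _ ENNReal.ofReal_ne_top]
  refine lintegral_mono fun t => ?_
  simp only [expRootInv]
  split_ifs with h
  -- At `t = 1` the right side is infinite, so no bound on `Q` is needed there.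
  · rw [ENNReal.mul_top (by simpa using hM.ne')]
    exact le_top
  · rw [← ENNReal.ofReal_mul (by positivity)]
    refine ENNReal.ofReal_le_ofReal ?_
    have h1 := hQ _ h (Complex.abs_arg_le_pi t)
    rw [Circle.exp_arg] at h1
    calc ‖Q.eval (t : ℂ)‖ ^ 2 ≤ (M * Real.exp (β / (2 * |Complex.arg t|))) ^ 2 := by gcongr
      _ = M ^ 2 * Real.exp (β / |Complex.arg t|) := by
        rw [mul_pow, ← Real.exp_nat_mul]
        congr 2
        push_cast
        field_simp

lemma e_nonneg (ρ : Measure Circle) [IsFiniteMeasure ρ] (n : ℕ) : 0 ≤ e ρ n :=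
  Metric.infDist_nonneg

theorem exists_e_le {β : ℝ} (hβ : 0 < β) (I : ℝ≥0) : ∃ C : ℝ, 0 < C ∧
    ∀ (ρ : Measure Circle) [IsFiniteMeasure ρ],
      ∫⁻ t, expRootInv β t ∂ρ ≤ (I : ℝ≥0∞) →
      ∀ n : ℕ, 1 ≤ n → e ρ n ≤ C * (n : ℝ) ^ (-(1 / (16 * Real.pi) * β)) := by
  obtain ⟨C, hC, H⟩ := exists_poly_small_off_one hβ
  -- `I ≤ (I + 1)²` avoids a square root and keeps the constant positive when `I = 0`.
  refine ⟨C * (I + 1), by positivity, fun ρ _ hρ n hn => ?_⟩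
  obtain ⟨Q, hdeg, hQ0, hQ⟩ := H n hn
  have hn0 : (0 : ℝ) < n := by exact_mod_cast hn
  set M : ℝ := C * (n : ℝ) ^ (-(1 / (16 * Real.pi) * β)) with hMdef
  have hM : 0 < M := by positivity
  have hmem : polyLp ρ (1 - Q) ∈ polyLp ρ '' polyZero n := by
    refine Set.mem_image_of_mem _ ⟨(natDegree_sub_le _ _).trans ?_, by simp [hQ0]⟩
    simpa using hdeg
  refine (Metric.infDist_le_dist_of_mem hmem).trans ?_
  have h1 := (lintegral_norm_sq_le hM hQ ρ).trans (mul_le_mul_right hρ _)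
  have h2 := ofReal_dist_sq ρ (1 - Q)
  rw [sub_sub_cancel] at h2
  rw [← h2, ← ENNReal.ofReal_coe_nnreal, ← ENNReal.ofReal_mul (by positivity),
    ENNReal.ofReal_le_ofReal_iff (by positivity)] at h1
  have hI : (0 : ℝ) ≤ I := I.coe_nonneg
  have h3 : dist (polyLp ρ 1) (polyLp ρ (1 - Q)) ≤ M * (I + 1) := by
    refine le_of_sq_le_sq ?_ (by positivity)
    rw [mul_pow]
    refine h1.trans ?_
    gcongr
    nlinarith
  refine h3.trans (le_of_eq ?_)
  rw [hMdef]; ring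

lemma conditionTheta_of_e_le {ρ : Measure Circle} [IsFiniteMeasure ρ] {C γ : ℝ} (hγ : 1 / 2 < γ)
    (h : ∀ n : ℕ, 1 ≤ n → e ρ n ≤ C * (n : ℝ) ^ (-γ)) : ConditionTheta ρ := by
  have h1 : Summable fun n : ℕ => C ^ 2 * (n : ℝ) ^ (-(2 * γ)) :=
    (Real.summable_nat_rpow.2 (by linarith)).mul_left _
  have h2 := (summable_nat_add_iff 1).2 h1
  refine Summable.of_nonneg_of_le (fun n => sq_nonneg _) (fun n => ?_) h2
  calc e ρ (n + 1) ^ 2 ≤ (C * ((n + 1 : ℕ) : ℝ) ^ (-γ)) ^ 2 :=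
        pow_le_pow_left₀ (e_nonneg _ _) (h (n + 1) (by omega)) 2
    _ = _ := by
      rw [mul_pow, ← Real.rpow_mul_natCast (by positivity)]
      congr 2
      push_cast
      ring

/-! ### Lower bound -/

lemma lintegral_m {f : Circle → ℝ≥0∞} (hf : Measurable f) : ∫⁻ t, f t ∂m =
    (ENNReal.ofReal (2 * Real.pi))⁻¹ *
      ∫⁻ θ in Set.Ioc (-Real.pi) Real.pi, f (Circle.exp θ) := by
  rw [m, lintegral_smul_measure, lintegral_map hf Circle.exp.continuous.measurable, smul_eq_mul]

lemma expRoot_circleExp (β : ℝ) {θ : ℝ} (hθ : θ ∈ Set.Ioc (-Real.pi) Real.pi) (h0 : θ ≠ 0) :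
    expRoot β (Circle.exp θ) = ENNReal.ofReal (Real.exp (-β / |θ|)) := by
  rw [expRoot, Circle.arg_exp hθ.1 hθ.2, if_neg h0]

/-- The arc `|θ| < d` is discarded; the factor `2π` undoes the normalization of `m`. -/
lemma weightedSq_integral_le_lintegral (β : ℝ) (Q : ℂ[X]) {d : ℝ} (hd : 0 < d)
    (hdπ : d ≤ Real.pi) :
    ENNReal.ofReal ((∫ θ in (-Real.pi)..(-d), weightedSq β Q θ)
        + ∫ θ in d..Real.pi, weightedSq β Q θ)
      ≤ ENNReal.ofReal (2 * Real.pi) *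
        ∫⁻ t : Circle, ENNReal.ofReal (‖Q.eval (t : ℂ)‖ ^ 2) ∂m.withDensity (expRoot β) := by
  have hpi := Real.pi_pos
  have hcont : Continuous fun t : Circle => ‖Q.eval (t : ℂ)‖ ^ 2 :=
    (Q.continuous.comp continuous_subtype_val).norm.pow 2
  have hmeas : Measurable fun t : Circle => ENNReal.ofReal (‖Q.eval (t : ℂ)‖ ^ 2) :=
    hcont.measurable.ennreal_ofReal
  have piece {p q : ℝ} (hpq : p ≤ q) (hsub : Set.Ioc p q ⊆ Set.Ioc (-Real.pi) Real.pi)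
      (h0 : (0 : ℝ) ∉ Set.uIcc p q) : ENNReal.ofReal (∫ θ in p..q, weightedSq β Q θ)
        = ∫⁻ θ in Set.Ioc p q, expRoot β (Circle.exp θ) *
            ENNReal.ofReal (‖Q.eval (Circle.exp θ : ℂ)‖ ^ 2) := by
    rw [intervalIntegral.integral_of_le hpq, ofReal_integral_eq_lintegral_ofReal
      (intervalIntegrable_weightedSq β Q h0).1 (ae_of_all _ (weightedSq_nonneg β Q))]
    refine setLIntegral_congr_fun measurableSet_Ioc fun θ hθ => ?_
    have hne : θ ≠ 0 := by
      rintro rfl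
      exact h0 (Set.Icc_subset_uIcc (Set.Ioc_subset_Icc_self hθ))
    rw [expRoot_circleExp β (hsub hθ) hne, weightedSq, ← ENNReal.ofReal_mul (Real.exp_pos _).le,
      mul_comm]
  rw [lintegral_withDensity_eq_lintegral_mul _ (measurable_expRoot β) hmeas,
    lintegral_m ((measurable_expRoot β).mul hmeas), ← mul_assoc,
    ENNReal.mul_inv_cancel (by simpa using hpi) ENNReal.ofReal_ne_top, one_mul,
    ENNReal.ofReal_add (intervalIntegral.integral_nonneg (by linarith) fun θ _ =>
      weightedSq_nonneg β Q θ) (intervalIntegral.integral_nonneg hdπ fun θ _ =>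
      weightedSq_nonneg β Q θ),
    piece (by linarith) (Set.Ioc_subset_Ioc le_rfl (by linarith))
      (by rw [Set.uIcc_of_le (by linarith), Set.mem_Icc]; rintro ⟨_, h⟩; linarith),
    piece hdπ (Set.Ioc_subset_Ioc (by linarith) le_rfl)
      (by rw [Set.uIcc_of_le hdπ, Set.mem_Icc]; rintro ⟨h, _⟩; linarith),
    ← lintegral_union measurableSet_Ioc
      (Set.disjoint_left.2 fun θ h1 h2 => by linarith [h1.2, h2.1])]
  refine lintegral_mono_set (Set.union_subset ?_ ?_)
  · exact Set.Ioc_subset_Ioc le_rfl (by linarith)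
  · exact Set.Ioc_subset_Ioc (by linarith) le_rfl

theorem exists_le_e (β : ℝ) {a : ℝ≥0} (ha : 0 < a) : ∃ c : ℝ, 0 < c ∧
    ∀ (ρ : Measure Circle) [IsFiniteMeasure ρ], a • m.withDensity (expRoot β) ≤ ρ →
      ∀ n : ℕ, 1 ≤ n → c * (n : ℝ) ^ (-(β / (2 * Real.pi))) ≤ e ρ n := by
  have hpi := Real.pi_pos
  obtain ⟨c, hc, H⟩ := exists_weightedSq_integral_ge β
  -- Solves `2π D² ≥ a c n^{-β/π}` for the distance `D`; the square root also halves the exponent.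
  refine ⟨√(a * c / (2 * Real.pi)), by positivity, fun ρ _ hρ n hn => ?_⟩
  have hn1 : (1 : ℝ) ≤ n := by exact_mod_cast hn
  have hn0 : (0 : ℝ) < n := by linarith
  have hd0 : 0 < 1 / (n : ℝ) := by positivity
  have hd1 : 1 / (n : ℝ) ≤ 1 := (div_le_one hn0).2 hn1
  have hne : (polyLp ρ '' polyZero n).Nonempty := ⟨_, Set.mem_image_of_mem _ ⟨by simp, eval_zero⟩⟩
  refine (Metric.le_infDist hne).2 ?_
  rintro _ ⟨P, ⟨hdeg, hP0⟩, rfl⟩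
  have hQdeg : (1 - P).natDegree ≤ n := (natDegree_sub_le _ _).trans (by simpa using hdeg)
  have h1 := H n hn (1 - P) hQdeg (by simp [hP0])
  have h2 := weightedSq_integral_le_lintegral β (1 - P) hd0 (by linarith [Real.pi_gt_three])
  have h3 := lintegral_mono' hρ (le_refl fun t : Circle =>
    ENNReal.ofReal (‖(1 - P).eval (t : ℂ)‖ ^ 2))
  rw [← ofReal_dist_sq ρ, lintegral_smul_measure, ENNReal.smul_def, smul_eq_mul] at h3
  set D := dist (polyLp ρ 1) (polyLp ρ P)
  have h4 : ENNReal.ofReal (a * (c * (n : ℝ) ^ (-(β / Real.pi))))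
      ≤ ENNReal.ofReal (2 * Real.pi * D ^ 2) := by
    rw [ENNReal.ofReal_mul a.coe_nonneg, ENNReal.ofReal_mul (by positivity : 0 ≤ 2 * Real.pi)]
    calc _ ≤ (a : ℝ≥0∞) * (ENNReal.ofReal (2 * Real.pi) * ∫⁻ t : Circle,
            ENNReal.ofReal (‖(1 - P).eval (t : ℂ)‖ ^ 2) ∂m.withDensity (expRoot β)) := by
          exact mul_le_mul' (by simp) ((ENNReal.ofReal_le_ofReal h1).trans h2)
      _ = ENNReal.ofReal (2 * Real.pi) * (a * ∫⁻ t : Circle,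
            ENNReal.ofReal (‖(1 - P).eval (t : ℂ)‖ ^ 2) ∂m.withDensity (expRoot β)) :=
          mul_left_comm _ _ _
      _ ≤ _ := mul_le_mul_right h3 _
  rw [ENNReal.ofReal_le_ofReal_iff (by positivity)] at h4
  refine le_of_sq_le_sq ?_ dist_nonneg
  rw [mul_pow, Real.sq_sqrt (by positivity), ← Real.rpow_mul_natCast hn0.le]
  have h5 : -(β / (2 * Real.pi)) * ((2 : ℕ) : ℝ) = -(β / Real.pi) := by
    push_cast; field_simp
  rw [h5, div_mul_eq_mul_div, div_le_iff₀ (by positivity)]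
  linarith

lemma not_conditionTheta_of_le_e {ρ : Measure Circle} [IsFiniteMeasure ρ] {c γ : ℝ} (hc : 0 < c)
    (hγ : γ ≤ 1 / 2) (h : ∀ n : ℕ, 1 ≤ n → c * (n : ℝ) ^ (-γ) ≤ e ρ n) :
    ¬ ConditionTheta ρ := by
  intro hρ
  have h1 : Summable fun n : ℕ => c ^ 2 * ((n + 1 : ℕ) : ℝ) ^ (-(2 * γ)) := by
    refine Summable.of_nonneg_of_le (fun n => by positivity) (fun n => ?_) hρ
    calc _ = (c * ((n + 1 : ℕ) : ℝ) ^ (-γ)) ^ 2 := by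
          rw [mul_pow, ← Real.rpow_mul_natCast (by positivity)]
          congr 2
          push_cast
          ring
      _ ≤ _ := pow_le_pow_left₀ (by positivity) (h (n + 1) (by omega)) 2
  rw [summable_mul_left_iff (by positivity)] at h1
  have h2 := (summable_nat_add_iff (f := fun n : ℕ => (n : ℝ) ^ (-(2 * γ))) 1).1 h1
  rw [Real.summable_nat_rpow] at h2
  linarith

end ExpRoot

end

theorem theorem5p1 :
    -- (A)
    (∃ K : ℝ, 0 < K ∧ ∀ β : ℝ, 0 < β →
      (∀ I : ℝ≥0, ∃ C : ℝ, 0 < C ∧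
        ∀ (ρ : Measure Circle) [IsFiniteMeasure ρ],
          ∫⁻ t, ExpRoot.expRootInv β t ∂ρ ≤ (I : ℝ≥0∞) →
          ∀ n : ℕ, 1 ≤ n → ExpRoot.e ρ n ≤ C * (n : ℝ) ^ (-(K * β))) ∧
      (1 / (2 * K) < β →
        ∀ (ρ : Measure Circle) [IsFiniteMeasure ρ],
          ∫⁻ t, ExpRoot.expRootInv β t ∂ρ < ∞ → ExpRoot.ConditionTheta ρ)) ∧
    -- (B)
    (∀ β : ℝ, 0 < β → ∀ a : ℝ≥0, 0 < a →
      (∃ c : ℝ, 0 < c ∧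
        ∀ (ρ : Measure Circle) [IsFiniteMeasure ρ],
          a • ExpRoot.m.withDensity (ExpRoot.expRoot β) ≤ ρ →
          ∀ n : ℕ, 1 ≤ n → c * (n : ℝ) ^ (-(β / (2 * Real.pi))) ≤ ExpRoot.e ρ n) ∧
      (β ≤ Real.pi →
        ∀ (ρ : Measure Circle) [IsFiniteMeasure ρ],
          a • ExpRoot.m.withDensity (ExpRoot.expRoot β) ≤ ρ → ¬ ExpRoot.ConditionTheta ρ)) := by
  have hpi := Real.pi_pos
  refine ⟨⟨1 / (16 * Real.pi), by positivity, fun β hβ => ⟨ExpRoot.exists_e_le hβ, ?_⟩⟩,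
    fun β _ a ha => ⟨ExpRoot.exists_le_e β ha, ?_⟩⟩
  · intro hK ρ _ hρ
    obtain ⟨C, _, H⟩ := ExpRoot.exists_e_le hβ (∫⁻ t, ExpRoot.expRootInv β t ∂ρ).toNNReal
    refine ExpRoot.conditionTheta_of_e_le ?_ (H ρ (ENNReal.coe_toNNReal hρ.ne).ge)
    rw [div_lt_iff₀ (by positivity)] at hK
    linarith
  · intro hβπ ρ _ hρ
    obtain ⟨c, hc, H⟩ := ExpRoot.exists_le_e β ha
    refine ExpRoot.not_conditionTheta_of_le_e hc ?_ (H ρ hρ)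
    rw [div_le_div_iff₀ (by positivity) two_pos]
    linarith
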